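/- Let $g\ge 0$ and let $\mathbb R\langle x\rangle=\mathbb R\langle x_1,\dots,x_g\rangle$ be the free algebra of nc polynomials, i.e. finite sums $p=\sum_w c_w w$ over words $w$ in the non-commuting variables $x_1,\dots,x_g$. The degree of $p$ is the largest length of a word $w$ with $c_w\neq 0$. Let $p\mapsto p^T$ be the linear involution that reverses words and fixes each $x_j$; $p$ is symmetric if $p^T=p$. Let $\mathbb S_n^g$ be the space of $g$-tuples $X=(X_1,\dots,X_g)$ of real symmetric $n\times n$ matrices; $p(X)\in\mathbb R^{n\times n}$ is the value of $p$ at $X\in\mathbb S_n^g$, with constant term $c$ giving $cI_n$. The derivative $p'(x)[h]$ is the coefficient of $t$ in $p(x+th)-p(x)$, and the Hessian $p''(x)[h]$ is the coefficient of $t$ in $p'(x+th)[h]-p'(x)[h]$; both are nc polynomials in the $2g$ variables $x,h$, so for $X,H\in\mathbb S_n^g$ one has $p'(X)[H]=\frac{d}{dt}p(X+tH)|_{t=0}$ and $p''(X)[H]=\frac{d^2}{dt^2}p(X+tH)|_{t=0}$. For a symmetric nc polynomial $p$ let $$\mathcal V(p)=\bigcup_{n\ge 1}\{(X,v)\in\mathbb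 S_n^g\times\mathbb R^n:\ p(X)v=0\}.$$ A point $(X,v)\in\mathcal V(p)$ with $X\in\mathbb S_n^g$ is a full rank point for $p$ if the map $\mathbb S_n^g\ni H\mapsto p'(X)[H]v\in\mathbb R^n$ is onto. $\mathcal V(p)$ has positive curvature at $(X,v)\in\mathcal V(p)$ if the clamped second fundamental form is nonnegative there, i.e. $-\langle p''(X)[H]v,v\rangle\ge 0$ for every $H\in\mathbb S_n^g$ with $p'(X)[H]v=0$. A set $\mathcal O$ of tuples of symmetric matrices of all sizes is algebraically open if $\mathcal O=\bigcap_{q\in\mathcal Q}\{X:\ q(X)\succ 0\}$ for some finite set $\mathcal Q$ of symmetric nc polynomials. For an integer $k\ge 0$, $p$ is a $k$-minimum degree defining polynomial for a set $\mathcal S$ if (1) $\mathcal S$ is a nonempty subset of $\mathcal V(p)$; (2) every nonzero nc polynomial $q$, not necessarily symmetric, with $q(X)v=0$ for all $(X,v)\in\mathcal S$ satisfies $\deg q\ge\deg p-k$; and (3) there is a nonzero nc polynomial $q$, not necessarily symmetric, with $\deg q=\deg p-k$ and $q(X)v=0$ for all $(X,v)\in\mathcal S$. **Corollary.** Let $p\in\mathbb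 R\langle x\rangle$ be a symmetric nc polynomial, let $\mathcal O$ be an algebraically open set, and let $\mathcal S$ be the set of full rank points $(X,v)$ of $p$ in $\mathcal V(p)$ with $X\in\mathcal O$. Suppose that (i) $\mathcal S$ contains a point $(X,v)$ with $n=1$, i.e. $(X,v)\in\mathbb R^g\times\mathbb R$; (ii) $\mathcal V(p)$ has positive curvature at each point of $\mathcal S$; and (iii) $p$ is a $0$-minimum degree defining polynomial for $\mathcal S$. Then $p$ has degree at most two and $p$ is (matrix) concave: for all $n$, all $X,Y\in\mathbb S_n^g$ and all $0\le t\le 1$, $$t\,p(X)+(1-t)\,p(Y)\ \preceq\ p(tX+(1-t)Y).$$ -/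

import Mathlib

/-- The free algebra `ℝ⟨x₁, …, x_g⟩` of nc polynomials in the variables `x i`, `i : Fin g`.  Its
`star` is the real-linear anti-automorphism that reverses words and fixes every variable. -/
abbrev NCPoly (g : ℕ) : Type := FreeAlgebra ℝ (Fin g)

/-- The free algebra `ℝ⟨x, h⟩` in `2g` variables: `Sum.inl i` is `x i` and `Sum.inr i` is `h i`. -/
abbrev NCPoly₂ (g : ℕ) : Type := FreeAlgebra ℝ (Fin g ⊕ Fin g)

namespace NCPoly

/-- A polynomial is symmetric if it equals its own transpose. -/
def IsSymmetric {g : ℕ} (p : NCPoly g) : Prop := star p = p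

/-- The degree: the largest length of a word that appears in `p` with a nonzero coefficient
(and `0` for the zero polynomial). -/
noncomputable def degree {g : ℕ} (p : NCPoly g) : ℕ :=
  (FreeAlgebra.equivMonoidAlgebraFreeMonoid (R := ℝ) (X := Fin g) p).coeff.support.sup
    FreeMonoid.length

/-- The `g`-tuples of real symmetric `n × n` matrices. -/
def symTuples (g n : ℕ) : Submodule ℝ (Fin g → Matrix (Fin n) (Fin n) ℝ) where
  carrier := {X | ∀ i, (X i).IsSymm}
  add_mem' hX hY := fun i => (hX i).add (hY i)
  zero_mem' := fun _ => Matrix.transpose_zero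
  smul_mem' c _ hX := fun i => (hX i).smul c

/-- The value `p(X)`; a constant `c` is sent to `c • 1`. -/
noncomputable def eval {g n : ℕ} (p : NCPoly g) (X : symTuples g n) :
    Matrix (Fin n) (Fin n) ℝ :=
  FreeAlgebra.lift ℝ (X : Fin g → Matrix (Fin n) (Fin n) ℝ) p

/-- The value `q(X)[H]` of a polynomial in the variables `x` and `h`. -/
noncomputable def eval₂ {g n : ℕ} (q : NCPoly₂ g) (X H : symTuples g n) :
    Matrix (Fin n) (Fin n) ℝ :=
  FreeAlgebra.lift ℝ (Sum.elim (X : Fin g → Matrix (Fin n) (Fin n) ℝ)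
    (H : Fin g → Matrix (Fin n) (Fin n) ℝ)) q

/-- `q(x + t h)[h]` for a polynomial `q(x)[h]`, as a polynomial in a central variable `t`. -/
noncomputable def shift {g : ℕ} : NCPoly₂ g →ₐ[ℝ] Polynomial (NCPoly₂ g) :=
  FreeAlgebra.lift ℝ (Sum.elim
    (fun i => Polynomial.C (FreeAlgebra.ι ℝ (Sum.inl i)) +
      Polynomial.X * Polynomial.C (FreeAlgebra.ι ℝ (Sum.inr i)))
    (fun i => Polynomial.C (FreeAlgebra.ι ℝ (Sum.inr i))))

/-- The directional derivative in `x` in the direction `h` of a polynomial `q(x)[h]`: the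
coefficient of `t` in `q(x + t h)[h] - q(x)[h]`. -/
noncomputable def dirDeriv {g : ℕ} (q : NCPoly₂ g) : NCPoly₂ g := (shift q).coeff 1

/-- The derivative `p'(x)[h]`. -/
noncomputable def deriv {g : ℕ} (p : NCPoly g) : NCPoly₂ g :=
  dirDeriv (FreeAlgebra.lift ℝ (fun i : Fin g => FreeAlgebra.ι ℝ (Sum.inl i : Fin g ⊕ Fin g)) p)

/-- The Hessian `p''(x)[h]`. -/
noncomputable def hessian {g : ℕ} (p : NCPoly g) : NCPoly₂ g := dirDeriv (deriv p)

/-- Pairs `(X, v)` of a `g`-tuple of symmetric `n × n` matrices and a vector in `ℝⁿ`, all `n`. -/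
abbrev Point (g : ℕ) : Type := Σ n : ℕ, symTuples g n × (Fin n → ℝ)

/-- The variety `V(p) = ⋃_{n ≥ 1} {(X, v) : p(X) v = 0}`. -/
def variety {g : ℕ} (p : NCPoly g) : Set (Point g) :=
  {P | 1 ≤ P.1 ∧ (eval p P.2.1).mulVec P.2.2 = 0}

/-- The clamped tangent plane `{H : p'(X)[H] v = 0}` at `(X, v)`. -/
def clampedTangent {g : ℕ} (p : NCPoly g) (P : Point g) : Set (symTuples g P.1) :=
  {H | (eval₂ (deriv p) P.2.1 H).mulVec P.2.2 = 0}

/-- The clamped second fundamental form `H ↦ -⟨p''(X)[H] v, v⟩` at `(X, v)`. -/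
noncomputable def secondFundamentalForm {g : ℕ} (p : NCPoly g) (P : Point g)
    (H : symTuples g P.1) : ℝ :=
  -dotProduct ((eval₂ (hessian p) P.2.1 H).mulVec P.2.2) P.2.2

/-- `V(p)` has positive (that is, nonnegative) curvature at `(X, v)`. -/
def HasPositiveCurvatureAt {g : ℕ} (p : NCPoly g) (P : Point g) : Prop :=
  ∀ H ∈ clampedTangent p P, 0 ≤ secondFundamentalForm p P H

/-- `(X, v)` is a full rank point for `p`: it lies in `V(p)` and `H ↦ p'(X)[H] v` is onto `ℝⁿ`. -/
def IsFullRankPoint {g : ℕ} (p : NCPoly g) (P : Point g) : Prop :=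
  P ∈ variety p ∧
    Function.Surjective (fun H : symTuples g P.1 => (eval₂ (deriv p) P.2.1 H).mulVec P.2.2)

/-- A set of `g`-tuples of symmetric matrices of all sizes is algebraically open if it is
`⋂_{q ∈ Q} {X : q(X) ≻ 0}` for some finite set `Q` of symmetric nc polynomials. -/
def IsAlgebraicallyOpen {g : ℕ} (O : Set (Σ n : ℕ, symTuples g n)) : Prop :=
  ∃ Q : Finset (NCPoly g), (∀ q ∈ Q, IsSymmetric q) ∧ O = {Y | ∀ q ∈ Q, (eval q Y.2).PosDef}

/-- The full rank points of `p` in `V(p) ∩ O`. -/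
def fullRankPoints {g : ℕ} (p : NCPoly g) (O : Set (Σ n : ℕ, symTuples g n)) : Set (Point g) :=
  {P | IsFullRankPoint p P ∧ (⟨P.1, P.2.1⟩ : Σ n : ℕ, symTuples g n) ∈ O}

/-- The polynomial `q` annihilates `S`: `q(X) v = 0` for every `(X, v) ∈ S`. -/
def VanishesOn {g : ℕ} (q : NCPoly g) (S : Set (Point g)) : Prop :=
  ∀ P ∈ S, (eval q P.2.1).mulVec P.2.2 = 0

/-- `p` is a `k`-minimum degree defining polynomial for `S`.  The inequality
`deg q ≥ deg p - k` is written without truncated subtraction. -/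
structure IsMinDegreeDefining {g : ℕ} (k : ℕ) (p : NCPoly g) (S : Set (Point g)) : Prop where
  symmetric : IsSymmetric p
  nonempty : S.Nonempty
  subset : S ⊆ variety p
  degree_le : ∀ q : NCPoly g, q ≠ 0 → VanishesOn q S → degree p ≤ degree q + k
  attained : ∃ q : NCPoly g, q ≠ 0 ∧ degree q + k = degree p ∧ VanishesOn q S

/-- `p` is (matrix) concave: `t p(X) + (1 - t) p(Y) ⪯ p(t X + (1 - t) Y)` for all tuples `X`, `Y`
of symmetric matrices of the same size and all `0 ≤ t ≤ 1`. -/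
def IsConcave {g : ℕ} (p : NCPoly g) : Prop :=
  ∀ (n : ℕ) (X Y : symTuples g n) (t : ℝ), 0 ≤ t → t ≤ 1 →
    (eval p (t • X + (1 - t) • Y) - (t • eval p X + (1 - t) • eval p Y)).PosSemidef

end NCPoly

/-!
Two features drive the argument: full rank points in an algebraically open set are closed under
direct sums, and a direct sum with two copies of a scalar point admits a direction `H` along which
both the tangency condition and the Hessian can be computed word by word.

Let `p` have degree `d = m + 1`, with `m ≥ 1`. By minimality no nonzero polynomial of degree at
most `m` annihilates all full rank points, and by direct sums some single full rank point `(X, v)`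
is annihilated by none (`exists_point_not_annihilated`). Add two copies of the scalar point
`(c, w)`, and let `v'` be the vector of the sum. The difference `e` of the two copies is orthogonal
to `v'` and a joint eigenvector with eigenvalue `c`. Expand `p` around `c` (`translate`), and let
`A` be the tuple of the sum shifted by `c`, so that every `A i` kills `e`. For
`H i = e (b i)ᵀ + (b i) eᵀ` with `b i` orthogonal to `e`, the vectors `H i w(A) v'` are multiples
of `e`, and since the `w(A) v'` with `w` of length at most `m` are linearly independent, the
multiples can be prescribed: there is one free weight `z u` for every nonempty word `u` of length
at most `d`. If `p = ∑ c_u u` after the translation, then `H` is tangent exactly when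
`∑ c_u z u = 0`, and the second fundamental form at `H` is a negative multiple of
`∑ c_u ∑ z (a.reverse) * z b`, the inner sum over the factorizations `u = a ++ b` into nonempty
words. Hence positive curvature makes this Hankel-type form nonpositive on the hyperplane
`∑ c_u z u = 0` (`exists_translate_pair_splitSum_nonpos`).

The weights of words of length `d` do not enter the form, yet they suffice to reach the
hyperplane, so the form is nonpositive without any constraint on the other weights. If `d ≥ 3` and
`i :: b` is a word of length `d` in `p`, the form restricted to the weights of `[i]` and `b` has a
zero diagonal entry and a nonzero off-diagonal entry, a contradiction
(`exists_pair_splitSum_pos`). If `d = 2`, the form is the quadratic part of `p`, which is therefore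
negative semidefinite (`pair_quadWeight_nonpos`), and this is concavity
(`dotProduct_concavity_defect`).
-/

namespace NCPoly
open Matrix

/-! ### Words, coefficients and translations -/

/-- The word with letters `l`, as a monomial of the free algebra. -/
noncomputable def word {g : ℕ} (l : List (Fin g)) : NCPoly g := (l.map (FreeAlgebra.ι ℝ)).prod

@[simp] lemma word_nil {g : ℕ} : word ([] : List (Fin g)) = 1 := rfl

lemma word_cons {g : ℕ} (i : Fin g) (l : List (Fin g)) :
    word (i :: l) = FreeAlgebra.ι ℝ i * word l := by simp [word]

lemma word_append {g : ℕ} (l m : List (Fin g)) : word (l ++ m) = word l * word m := by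
  simp [word]

lemma basisFreeMonoid_apply {g : ℕ} (w : FreeMonoid (Fin g)) :
    FreeAlgebra.basisFreeMonoid ℝ (Fin g) w = word w.toList := by
  simp [FreeAlgebra.basisFreeMonoid, FreeAlgebra.equivMonoidAlgebraFreeMonoid, word,
    FreeMonoid.lift_apply, MonoidAlgebra.lift_single]

/-- The linear functional on nc polynomials with prescribed values `z` on words. -/
noncomputable def pair {g : ℕ} (z : List (Fin g) → ℝ) : NCPoly g →ₗ[ℝ] ℝ :=
  (FreeAlgebra.basisFreeMonoid ℝ (Fin g)).constr ℝ fun w => z w.toList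

@[simp] lemma pair_word {g : ℕ} (z : List (Fin g) → ℝ) (l : List (Fin g)) :
    pair z (word l) = z l := by
  have := (FreeAlgebra.basisFreeMonoid ℝ (Fin g)).constr_basis ℝ
    (fun w => z w.toList) (FreeMonoid.ofList l)
  simpa [basisFreeMonoid_apply, pair] using this

lemma linearMap_ext_word {g : ℕ} {M : Type*} [AddCommMonoid M] [Module ℝ M]
    {φ ψ : NCPoly g →ₗ[ℝ] M} (h : ∀ l, φ (word l) = ψ (word l)) : φ = ψ :=
  (FreeAlgebra.basisFreeMonoid ℝ (Fin g)).ext fun w => by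
    simpa [basisFreeMonoid_apply] using h w.toList

open Classical in
/-- The coefficient of the word `l`, as a linear functional. -/
noncomputable def coef {g : ℕ} (l : List (Fin g)) : NCPoly g →ₗ[ℝ] ℝ :=
  pair fun m => if m = l then 1 else 0

open Classical in
lemma coef_word {g : ℕ} (l m : List (Fin g)) :
    coef l (word m) = if m = l then 1 else 0 := by simp [coef]

lemma coef_eq_repr {g : ℕ} (w : FreeMonoid (Fin g)) (p : NCPoly g) :
    coef w.toList p = (FreeAlgebra.basisFreeMonoid ℝ (Fin g)).repr p w := by
  classical
  have : coef w.toList = (FreeAlgebra.basisFreeMonoid ℝ (Fin g)).coord w := by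
    refine (FreeAlgebra.basisFreeMonoid ℝ (Fin g)).ext fun u => ?_
    rw [Module.Basis.coord_apply, Module.Basis.repr_self, basisFreeMonoid_apply, coef_word,
      Finsupp.single_apply]
    simp
  rw [this, Module.Basis.coord_apply]

/-- The nc polynomials of degree at most `m`, as the span of the words of length at most `m`. -/
noncomputable def wordsUpTo (g m : ℕ) : Submodule ℝ (NCPoly g) :=
  Submodule.span ℝ (word '' {l : List (Fin g) | l.length ≤ m})

lemma word_mem_wordsUpTo {g m : ℕ} {l : List (Fin g)} (h : l.length ≤ m) :
    word l ∈ wordsUpTo g m := Submodule.subset_span ⟨l, h, rfl⟩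

instance {g m : ℕ} : FiniteDimensional ℝ (wordsUpTo g m) :=
  FiniteDimensional.span_of_finite ℝ ((List.finite_length_le (Fin g) m).image word)

/-- Linear maps that agree on the words of length at most `m` agree in degree at most `m`. -/
lemma eqOn_wordsUpTo {g m : ℕ} {M : Type*} [AddCommMonoid M] [Module ℝ M]
    {φ ψ : NCPoly g →ₗ[ℝ] M} (h : ∀ l : List (Fin g), l.length ≤ m → φ (word l) = ψ (word l))
    {p : NCPoly g} (hp : p ∈ wordsUpTo g m) : φ p = ψ p := by
  refine LinearMap.eqOn_span (R := ℝ) (s := word '' {l : List (Fin g) | l.length ≤ m}) ?_ hp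
  rintro _ ⟨l, hl, rfl⟩
  exact h l hl

lemma mem_wordsUpTo_iff {g m : ℕ} {p : NCPoly g} :
    p ∈ wordsUpTo g m ↔ ∀ l : List (Fin g), m < l.length → coef l p = 0 := by
  classical
  constructor
  · intro hp l hl
    refine eqOn_wordsUpTo (φ := coef l) (ψ := 0) (fun u hu => ?_) hp
    rw [coef_word, if_neg (by rintro rfl; omega), LinearMap.zero_apply]
  · intro h
    rw [← (FreeAlgebra.basisFreeMonoid ℝ (Fin g)).linearCombination_repr p,
      Finsupp.linearCombination_apply]
    refine Submodule.sum_mem _ fun w hw => Submodule.smul_mem _ _ ?_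
    rw [basisFreeMonoid_apply]
    refine word_mem_wordsUpTo (not_lt.1 fun hl => ?_)
    exact Finsupp.mem_support_iff.1 hw (by rw [← coef_eq_repr]; exact h _ hl)

lemma degree_le_iff {g m : ℕ} {p : NCPoly g} : degree p ≤ m ↔ p ∈ wordsUpTo g m := by
  rw [mem_wordsUpTo_iff, degree, Finset.sup_le_iff]
  have key : ∀ w : FreeMonoid (Fin g),
      (FreeAlgebra.equivMonoidAlgebraFreeMonoid (R := ℝ) (X := Fin g) p).coeff w =
        coef w.toList p := fun w => by rw [coef_eq_repr]; rfl
  constructor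
  · intro h l hl
    by_contra hne
    have := h (FreeMonoid.ofList l) (Finsupp.mem_support_iff.2 (by rw [key]; exact hne))
    exact absurd hl (not_lt.2 this)
  · intro h w hw
    by_contra hlt
    exact Finsupp.mem_support_iff.1 hw (by rw [key]; exact h _ (not_le.1 hlt))

lemma exists_coef_ne_zero {g d : ℕ} {p : NCPoly g} (hd : p ∈ wordsUpTo g (d + 1))
    (hd' : p ∉ wordsUpTo g d) : ∃ l : List (Fin g), l.length = d + 1 ∧ coef l p ≠ 0 := by
  by_contra! h
  refine hd' (mem_wordsUpTo_iff.2 fun l hl => ?_)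
  rcases (Nat.succ_le_of_lt hl).eq_or_lt with e | e
  · exact h l e.symm
  · exact mem_wordsUpTo_iff.1 hd l e

lemma star_word {g : ℕ} (l : List (Fin g)) : star (word l) = word l.reverse := by
  induction l with
  | nil => simp
  | cons i l ih => simp [word_cons, word_append, ih]

lemma star_smul_poly {g : ℕ} (c : ℝ) (p : NCPoly g) : star (c • p) = c • star p := by
  rw [Algebra.smul_def, star_mul, FreeAlgebra.star_algebraMap, Algebra.smul_def,
    Algebra.commutes]

lemma coef_star {g : ℕ} (l : List (Fin g)) (p : NCPoly g) :
    coef l (star p) = coef l.reverse p := by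
  let S : NCPoly g →ₗ[ℝ] NCPoly g :=
    { toFun := star, map_add' := star_add, map_smul' := star_smul_poly }
  have : coef l ∘ₗ S = coef l.reverse := by
    refine linearMap_ext_word fun m => ?_
    change coef l (star (word m)) = _
    rw [star_word, coef_word, coef_word]
    simp [List.reverse_eq_iff]
  exact LinearMap.congr_fun this p

/-- The substitution `x i ↦ x i + c i`. -/
noncomputable def translate {g : ℕ} (c : Fin g → ℝ) : NCPoly g →ₐ[ℝ] NCPoly g :=
  FreeAlgebra.lift ℝ fun i => FreeAlgebra.ι ℝ i + algebraMap ℝ _ (c i)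

lemma translate_neg_translate {g : ℕ} (c : Fin g → ℝ) (p : NCPoly g) :
    translate (-c) (translate c p) = p := by
  have : (translate (-c)).comp (translate c) = AlgHom.id ℝ (NCPoly g) := by
    ext i; simp [translate]
  exact DFunLike.congr_fun this p

lemma star_translate {g : ℕ} (c : Fin g → ℝ) (p : NCPoly g) :
    star (translate c p) = translate c (star p) := by
  induction p using FreeAlgebra.induction with
  | grade0 r => simp
  | grade1 i => simp [translate]
  | mul a b ha hb => simp [ha, hb]
  | add a b ha hb => simp [ha, hb]

lemma ι_mul_mem_wordsUpTo {g m : ℕ} (i : Fin g) {p : NCPoly g} (hp : p ∈ wordsUpTo g m) :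
    FreeAlgebra.ι ℝ i * p ∈ wordsUpTo g (m + 1) := by
  induction hp using Submodule.span_induction with
  | mem x hx =>
    obtain ⟨l, hl, rfl⟩ := hx
    rw [← word_cons]
    exact word_mem_wordsUpTo (by simpa using hl)
  | zero => simp
  | add x y _ _ hx hy => rw [mul_add]; exact add_mem hx hy
  | smul c x _ hx => rw [mul_smul_comm]; exact Submodule.smul_mem _ _ hx

lemma wordsUpTo_mono {g m n : ℕ} (h : m ≤ n) : wordsUpTo g m ≤ wordsUpTo g n :=
  Submodule.span_mono (Set.image_mono fun _ hl => le_trans hl h)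

lemma translate_mem_wordsUpTo {g m : ℕ} (c : Fin g → ℝ) {p : NCPoly g}
    (hp : p ∈ wordsUpTo g m) : translate c p ∈ wordsUpTo g m := by
  have hw : ∀ l : List (Fin g), translate c (word l) ∈ wordsUpTo g l.length := by
    intro l
    induction l with
    | nil => simpa using word_mem_wordsUpTo (g := g) (l := []) (m := 0) le_rfl
    | cons i l ih =>
      rw [word_cons, map_mul, translate, FreeAlgebra.lift_ι_apply, ← translate, add_mul,
        ← Algebra.smul_def]
      exact add_mem (ι_mul_mem_wordsUpTo i ih)
        (Submodule.smul_mem _ _ (wordsUpTo_mono (by simp) ih))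
  induction hp using Submodule.span_induction with
  | mem x hx =>
    obtain ⟨l, hl, rfl⟩ := hx
    exact wordsUpTo_mono hl (hw l)
  | zero => simp
  | add x y _ _ hx hy => rw [map_add]; exact add_mem hx hy
  | smul c x _ hx => rw [map_smul]; exact Submodule.smul_mem _ _ hx

lemma translate_mem_wordsUpTo_iff {g m : ℕ} (c : Fin g → ℝ) {p : NCPoly g} :
    translate c p ∈ wordsUpTo g m ↔ p ∈ wordsUpTo g m :=
  ⟨fun h => by simpa [translate_neg_translate] using translate_mem_wordsUpTo (-c) h,
    translate_mem_wordsUpTo c⟩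

/-! ### Derivatives along lines -/

/-- The line `t ↦ q(X + t H)[H]`, as a matrix polynomial in `t`. -/
noncomputable def line₂ {g n : ℕ} (X H : symTuples g n) :
    NCPoly₂ g →ₐ[ℝ] Polynomial (Matrix (Fin n) (Fin n) ℝ) :=
  FreeAlgebra.lift ℝ (Sum.elim
    (fun i => Polynomial.C (X.1 i) + Polynomial.X * Polynomial.C (H.1 i))
    (fun i => Polynomial.C (H.1 i)))

/-- The line `t ↦ p(X + t H)`, as a matrix polynomial in `t`. -/
noncomputable def line {g n : ℕ} (X H : symTuples g n) :
    NCPoly g →ₐ[ℝ] Polynomial (Matrix (Fin n) (Fin n) ℝ) :=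
  FreeAlgebra.lift ℝ fun i => Polynomial.C (X.1 i) + Polynomial.X * Polynomial.C (H.1 i)

lemma coeff_zero_line₂ {g n : ℕ} (X H : symTuples g n) (q : NCPoly₂ g) :
    (line₂ X H q).coeff 0 = eval₂ q X H := by
  induction q using FreeAlgebra.induction with
  | grade0 r => simp [eval₂, Polynomial.algebraMap_apply]
  | grade1 i => cases i <;> simp [eval₂, line₂]
  | mul a b ha hb => rw [map_mul, Polynomial.mul_coeff_zero, ha, hb]; simp [eval₂]
  | add a b ha hb => rw [map_add, Polynomial.coeff_add, ha, hb]; simp [eval₂]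

lemma coeff_zero_shift {g : ℕ} (q : NCPoly₂ g) : (shift q).coeff 0 = q := by
  induction q using FreeAlgebra.induction with
  | grade0 r => simp [Polynomial.algebraMap_apply]
  | grade1 i => cases i <;> simp [shift]
  | mul a b ha hb => rw [map_mul, Polynomial.mul_coeff_zero, ha, hb]
  | add a b ha hb => rw [map_add, Polynomial.coeff_add, ha, hb]

lemma dirDeriv_mul {g : ℕ} (a b : NCPoly₂ g) :
    dirDeriv (a * b) = dirDeriv a * b + a * dirDeriv b := by
  simp only [dirDeriv, map_mul, Polynomial.mul_coeff_one, coeff_zero_shift]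
  exact add_comm _ _

/-- Differentiating along a line is the same as taking the nc directional derivative first. -/
lemma derivative_line₂ {g n : ℕ} (X H : symTuples g n) (q : NCPoly₂ g) :
    Polynomial.derivative (line₂ X H q) = line₂ X H (dirDeriv q) := by
  induction q using FreeAlgebra.induction with
  | grade0 r => simp [dirDeriv, Polynomial.algebraMap_apply]
  | grade1 i =>
    cases i <;> simp [dirDeriv, shift, line₂, Polynomial.coeff_C]
  | mul a b ha hb => rw [map_mul, Polynomial.derivative_mul, ha, hb, dirDeriv_mul]; simp
  | add a b ha hb => rw [map_add, Polynomial.derivative_add, ha, hb]; simp [dirDeriv]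

lemma line₂_inl {g n : ℕ} (X H : symTuples g n) (p : NCPoly g) :
    line₂ X H (FreeAlgebra.lift ℝ
      (fun i : Fin g => FreeAlgebra.ι ℝ (Sum.inl i : Fin g ⊕ Fin g)) p) = line X H p := by
  refine DFunLike.congr_fun (f := (line₂ X H).comp (FreeAlgebra.lift ℝ
      (fun i : Fin g => FreeAlgebra.ι ℝ (Sum.inl i : Fin g ⊕ Fin g)))) (g := line X H) ?_ p
  ext1
  funext i
  simp [line₂, line]

lemma eval₂_deriv {g n : ℕ} (p : NCPoly g) (X H : symTuples g n) :
    eval₂ (deriv p) X H = (line X H p).coeff 1 := by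
  rw [← coeff_zero_line₂, deriv, ← derivative_line₂, line₂_inl, Polynomial.coeff_derivative]
  simp

lemma eval₂_hessian {g n : ℕ} (p : NCPoly g) (X H : symTuples g n) :
    eval₂ (hessian p) X H = (2 : ℝ) • (line X H p).coeff 2 := by
  rw [← coeff_zero_line₂, hessian, deriv, ← derivative_line₂, ← derivative_line₂, line₂_inl,
    Polynomial.coeff_derivative, Polynomial.coeff_derivative]
  norm_num
  rw [two_smul, mul_two]

lemma eval_star {g n : ℕ} (p : NCPoly g) (X : symTuples g n) :
    eval (star p) X = (eval p X)ᵀ := by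
  induction p using FreeAlgebra.induction with
  | grade0 r => simp [eval, Matrix.algebraMap_eq_diagonal]
  | grade1 i => simpa [eval] using (X.2 i).symm
  | mul a b ha hb => simp only [eval, star_mul, map_mul, Matrix.transpose_mul] at *; rw [ha, hb]
  | add a b ha hb => simp only [eval, star_add, map_add, Matrix.transpose_add] at *; rw [ha, hb]

/-- The tuple of scalar matrices `c i`. -/
def scalarTuple {g : ℕ} (n : ℕ) (c : Fin g → ℝ) : symTuples g n :=
  ⟨fun i => c i • 1, fun i => by simp [Matrix.IsSymm]⟩

lemma line_translate {g n : ℕ} (c : Fin g → ℝ) (X H : symTuples g n) (p : NCPoly g) :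
    line (X - scalarTuple n c) H (translate c p) = line X H p := by
  refine DFunLike.congr_fun (f := (line (X - scalarTuple n c) H).comp (translate c))
    (g := line X H) ?_ p
  ext1
  funext i
  simp [line, translate, scalarTuple, Polynomial.algebraMap_apply,
    ← Algebra.algebraMap_eq_smul_one]
  abel

lemma eval_translate {g n : ℕ} (c : Fin g → ℝ) (X : symTuples g n) (p : NCPoly g) :
    eval (translate c p) (X - scalarTuple n c) = eval p X := by
  refine DFunLike.congr_fun (f := (FreeAlgebra.lift ℝ
    ((X - scalarTuple n c : symTuples g n) : Fin g → Matrix (Fin n) (Fin n) ℝ)).comp (translate c))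
    (g := FreeAlgebra.lift ℝ (X : Fin g → Matrix (Fin n) (Fin n) ℝ)) ?_ p
  ext1
  funext i
  simp [translate, scalarTuple, Algebra.algebraMap_eq_smul_one]

/-! ### Direct sums -/

/-- The block diagonal embedding of matrix algebras. -/
noncomputable def blockDiag (n m : ℕ) :
    Matrix (Fin n) (Fin n) ℝ × Matrix (Fin m) (Fin m) ℝ →ₐ[ℝ]
      Matrix (Fin (n + m)) (Fin (n + m)) ℝ :=
  ((Matrix.reindexAlgEquiv ℝ ℝ finSumFinEquiv).toAlgHom).comp
    (AlgHom.ofLinearMap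
      { toFun := fun A => Matrix.fromBlocks A.1 0 0 A.2
        map_add' := fun A B => by simp [Matrix.fromBlocks_add]
        map_smul' := fun c A => by simp [Matrix.fromBlocks_smul] }
      (by simp) (fun A B => by simp [Matrix.fromBlocks_multiply]))

lemma blockDiag_apply {n m : ℕ} (A : Matrix (Fin n) (Fin n) ℝ) (B : Matrix (Fin m) (Fin m) ℝ) :
    blockDiag n m (A, B) =
      (Matrix.fromBlocks A 0 0 B).submatrix finSumFinEquiv.symm finSumFinEquiv.symm := rfl

/-- The vector with blocks `v` and `w`. -/
def blockVec {n m : ℕ} (v : Fin n → ℝ) (w : Fin m → ℝ) : Fin (n + m) → ℝ :=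
  Sum.elim v w ∘ finSumFinEquiv.symm

lemma exists_eq_blockVec {n m : ℕ} (u : Fin (n + m) → ℝ) :
    ∃ (v : Fin n → ℝ) (w : Fin m → ℝ), u = blockVec v w := by
  refine ⟨fun i => u (finSumFinEquiv (Sum.inl i)), fun i => u (finSumFinEquiv (Sum.inr i)), ?_⟩
  funext k
  obtain ⟨k, rfl⟩ := finSumFinEquiv.surjective k
  cases k <;> simp [blockVec]

lemma blockDiag_mulVec {n m : ℕ} (A : Matrix (Fin n) (Fin n) ℝ) (B : Matrix (Fin m) (Fin m) ℝ)
    (v : Fin n → ℝ) (w : Fin m → ℝ) :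
    blockDiag n m (A, B) *ᵥ blockVec v w = blockVec (A *ᵥ v) (B *ᵥ w) := by
  rw [blockDiag_apply, Matrix.submatrix_mulVec_equiv, blockVec, blockVec]
  congr 1
  rw [Function.comp_assoc, Equiv.symm_symm, Equiv.symm_comp_self, Function.comp_id,
    Matrix.fromBlocks_mulVec]
  simp

lemma blockVec_eq_zero {n m : ℕ} {v : Fin n → ℝ} {w : Fin m → ℝ} :
    blockVec v w = 0 ↔ v = 0 ∧ w = 0 := by
  constructor
  · intro h
    constructor
    · funext i; simpa [blockVec] using congrFun h (finSumFinEquiv (Sum.inl i))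
    · funext i; simpa [blockVec] using congrFun h (finSumFinEquiv (Sum.inr i))
  · rintro ⟨rfl, rfl⟩
    funext k
    obtain ⟨k, rfl⟩ := finSumFinEquiv.surjective k
    cases k <;> simp [blockVec]

lemma blockVec_dotProduct {n m : ℕ} (v v' : Fin n → ℝ) (w w' : Fin m → ℝ) :
    blockVec v w ⬝ᵥ blockVec v' w' = v ⬝ᵥ v' + w ⬝ᵥ w' := by
  rw [dotProduct, ← finSumFinEquiv.sum_comp, Fintype.sum_sum_type]
  simp [blockVec, dotProduct]

lemma blockDiag_posDef {n m : ℕ} {A : Matrix (Fin n) (Fin n) ℝ} {B : Matrix (Fin m) (Fin m) ℝ}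
    (hA : A.PosDef) (hB : B.PosDef) : (blockDiag n m (A, B)).PosDef := by
  refine Matrix.PosDef.of_dotProduct_mulVec_pos ?_ fun x hx => ?_
  · rw [blockDiag_apply]
    exact (Matrix.IsHermitian.fromBlocks hA.1 (by simp) hB.1).submatrix _
  · obtain ⟨v, w, rfl⟩ := exists_eq_blockVec x
    rw [star_trivial, blockDiag_mulVec, blockVec_dotProduct]
    have h1 := hA.posSemidef.dotProduct_mulVec_nonneg v
    have h2 := hB.posSemidef.dotProduct_mulVec_nonneg w
    rw [star_trivial] at h1 h2
    by_cases hv : v = 0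
    · have hw : w ≠ 0 := fun hw => hx (blockVec_eq_zero.2 ⟨hv, hw⟩)
      have := hB.dotProduct_mulVec_pos hw
      rw [star_trivial] at this
      linarith
    · have := hA.dotProduct_mulVec_pos hv
      rw [star_trivial] at this
      linarith

/-- The direct sum of two tuples. -/
noncomputable def directSum {g n m : ℕ} (X : symTuples g n) (Y : symTuples g m) :
    symTuples g (n + m) :=
  ⟨fun i => blockDiag n m (X.1 i, Y.1 i), fun i => by
    beta_reduce
    rw [blockDiag_apply]
    exact (Matrix.IsSymm.fromBlocks (X.2 i) (by simp) (Y.2 i)).submatrix _⟩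

lemma lift_blockDiag {α : Type*} {n m : ℕ} (f : α → Matrix (Fin n) (Fin n) ℝ)
    (f' : α → Matrix (Fin m) (Fin m) ℝ) (q : FreeAlgebra ℝ α) :
    FreeAlgebra.lift ℝ (fun i => blockDiag n m (f i, f' i)) q =
      blockDiag n m (FreeAlgebra.lift ℝ f q, FreeAlgebra.lift ℝ f' q) := by
  refine DFunLike.congr_fun (g := (blockDiag n m).comp
    ((FreeAlgebra.lift ℝ f).prod (FreeAlgebra.lift ℝ f'))) ?_ q
  ext1
  funext i
  simp

lemma eval_directSum {g n m : ℕ} (p : NCPoly g) (X : symTuples g n) (Y : symTuples g m) :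
    eval p (directSum X Y) = blockDiag n m (eval p X, eval p Y) :=
  lift_blockDiag _ _ p

lemma eval₂_directSum {g n m : ℕ} (q : NCPoly₂ g) (X H : symTuples g n) (Y K : symTuples g m) :
    eval₂ q (directSum X Y) (directSum H K) = blockDiag n m (eval₂ q X H, eval₂ q Y K) := by
  rw [eval₂, eval₂, eval₂, ← lift_blockDiag]
  congr 2
  funext i
  cases i <;> rfl

/-- The full rank points in an algebraically open set are closed under direct sums. -/
lemma directSum_mem_fullRankPoints {g : ℕ} {p : NCPoly g} {O : Set (Σ n : ℕ, symTuples g n)}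
    (hO : IsAlgebraicallyOpen O) {n m : ℕ} {X : symTuples g n} {v : Fin n → ℝ}
    {Y : symTuples g m} {w : Fin m → ℝ} (hX : (⟨n, X, v⟩ : Point g) ∈ fullRankPoints p O)
    (hY : (⟨m, Y, w⟩ : Point g) ∈ fullRankPoints p O) :
    (⟨n + m, directSum X Y, blockVec v w⟩ : Point g) ∈ fullRankPoints p O := by
  obtain ⟨Q, -, rfl⟩ := hO
  obtain ⟨⟨⟨hn, hX0⟩, hXr⟩, hXO⟩ := hX
  obtain ⟨⟨⟨-, hY0⟩, hYr⟩, hYO⟩ := hY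
  dsimp only at hn hX0 hXr hXO hY0 hYr hYO
  refine ⟨⟨⟨hn.trans (Nat.le_add_right _ _), ?_⟩, ?_⟩, fun q hq => ?_⟩
  · change eval p (directSum X Y) *ᵥ blockVec v w = 0
    rw [eval_directSum, blockDiag_mulVec, hX0, hY0, blockVec_eq_zero]
    exact ⟨rfl, rfl⟩
  · intro u
    obtain ⟨u₁, u₂, rfl⟩ := exists_eq_blockVec (n := n) (m := m) u
    obtain ⟨H, hH⟩ := hXr u₁
    obtain ⟨K, hK⟩ := hYr u₂
    refine ⟨directSum H K, ?_⟩
    change eval₂ (deriv p) (directSum X Y) (directSum H K) *ᵥ blockVec v w = _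
    dsimp only at hH hK
    rw [eval₂_directSum, blockDiag_mulVec, hH, hK]
  · change (eval q (directSum X Y)).PosDef
    rw [eval_directSum]
    exact blockDiag_posDef (hXO q hq) (hYO q hq)

/-- If no nonzero polynomial of degree at most `m` annihilates the full rank points, then already
one of them is annihilated by none: a point with minimal annihilator works, as a direct sum with a
point outside the zero set of some annihilating polynomial would make the annihilator smaller. -/
lemma exists_point_not_annihilated {g m : ℕ} {p : NCPoly g} {O : Set (Σ n : ℕ, symTuples g n)}
    (hO : IsAlgebraicallyOpen O) (hne : (fullRankPoints p O).Nonempty)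
    (hS : ∀ q ∈ wordsUpTo g m, VanishesOn q (fullRankPoints p O) → q = 0) :
    ∃ P ∈ fullRankPoints p O, ∀ q ∈ wordsUpTo g m, eval q P.2.1 *ᵥ P.2.2 = 0 → q = 0 := by
  let L : ∀ P : Point g, NCPoly g →ₗ[ℝ] (Fin P.1 → ℝ) := fun P =>
    ((Matrix.mulVecBilin ℝ ℝ).flip : (Fin P.1 → ℝ) →ₗ[ℝ]
      Matrix (Fin P.1) (Fin P.1) ℝ →ₗ[ℝ] (Fin P.1 → ℝ)) P.2.2 ∘ₗ
      (FreeAlgebra.lift ℝ (P.2.1 : Fin g → Matrix (Fin P.1) (Fin P.1) ℝ)).toLinearMap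
  let K : Point g → Submodule ℝ (wordsUpTo g m) := fun P =>
    LinearMap.ker (L P ∘ₗ (wordsUpTo g m).subtype)
  have hK : ∀ P q, q ∈ K P ↔ eval (q : NCPoly g) P.2.1 *ᵥ P.2.2 = 0 := fun P q => Iff.rfl
  obtain ⟨_, ⟨P, hP, rfl⟩, hmin⟩ := (wellFounded_lt (α := Submodule ℝ (wordsUpTo g m))).has_min
    (K '' fullRankPoints p O) (hne.image K)
  refine ⟨P, hP, fun q hq hq0 => hS q hq fun R hR => ?_⟩
  by_contra hne
  obtain ⟨n, X, v⟩ := P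
  obtain ⟨k, Y, w⟩ := R
  have hsum := directSum_mem_fullRankPoints hO hP hR
  have key : ∀ r, r ∈ K ⟨n + k, directSum X Y, blockVec v w⟩ ↔
      r ∈ K ⟨n, X, v⟩ ∧ r ∈ K ⟨k, Y, w⟩ := by
    intro r
    rw [hK, hK, hK, eval_directSum, blockDiag_mulVec, blockVec_eq_zero]
  refine hmin _ ⟨_, hsum, rfl⟩ (lt_of_le_of_ne (fun r hr => ((key r).1 hr).1) fun h => hne ?_)
  have : (⟨q, hq⟩ : wordsUpTo g m) ∈ K ⟨n + k, directSum X Y, blockVec v w⟩ := by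
    rw [h]; exact hq0
  exact ((key _).1 this).2

/-! ### Second variation in a rank two direction -/

/-- `splitSum z r l` is the sum of `z (a.reverse ++ r) * z b` over the factorizations `l = a ++ b`
with `a` nonempty. -/
def splitSum {g : ℕ} (z : List (Fin g) → ℝ) : List (Fin g) → List (Fin g) → ℝ
  | _, [] => 0
  | r, i :: l => splitSum z (i :: r) l + z (i :: r) * z l

/-- The tuple of matrices `e (b i)ᵀ + (b i) eᵀ`. -/
def rankTwoTuple {g n : ℕ} (e : Fin n → ℝ) (b : Fin g → Fin n → ℝ) : symTuples g n :=
  ⟨fun i => vecMulVec e (b i) + vecMulVec (b i) e, fun i => by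
    rw [Matrix.IsSymm, transpose_add, transpose_vecMulVec, transpose_vecMulVec, add_comm]⟩

lemma rankTwoTuple_mulVec {g n : ℕ} (e : Fin n → ℝ) (b : Fin g → Fin n → ℝ) (i : Fin g)
    (x : Fin n → ℝ) :
    (rankTwoTuple e b).1 i *ᵥ x = (b i ⬝ᵥ x) • e + (e ⬝ᵥ x) • b i := by
  simp [rankTwoTuple, add_mulVec, vecMulVec_mulVec]

lemma symTuples_dotProduct {g n : ℕ} (A : symTuples g n) (i : Fin g) (x y : Fin n → ℝ) :
    (A.1 i *ᵥ x) ⬝ᵥ y = x ⬝ᵥ (A.1 i *ᵥ y) := by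
  rw [dotProduct_mulVec, ← mulVec_transpose, A.2 i]

lemma eval_word_cons {g n : ℕ} (A : symTuples g n) (i : Fin g) (l : List (Fin g))
    (v : Fin n → ℝ) :
    eval (word (i :: l)) A *ᵥ v = A.1 i *ᵥ (eval (word l) A *ᵥ v) := by
  simp [word_cons, eval]

lemma coeff_zero_line {g n : ℕ} (A H : symTuples g n) (p : NCPoly g) :
    (line A H p).coeff 0 = eval p A := by
  induction p using FreeAlgebra.induction with
  | grade0 r => simp [eval, Polynomial.algebraMap_apply]
  | grade1 i => simp [eval, line]
  | mul a b ha hb => rw [map_mul, Polynomial.mul_coeff_zero, ha, hb]; simp [eval]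
  | add a b ha hb => rw [map_add, Polynomial.coeff_add, ha, hb]; simp [eval]

lemma coeff_succ_line_word_cons {g n : ℕ} (A H : symTuples g n) (i : Fin g) (l : List (Fin g))
    (k : ℕ) (v : Fin n → ℝ) :
    (line A H (word (i :: l))).coeff (k + 1) *ᵥ v =
      A.1 i *ᵥ ((line A H (word l)).coeff (k + 1) *ᵥ v) +
        H.1 i *ᵥ ((line A H (word l)).coeff k *ᵥ v) := by
  have : line A H (word (i :: l)) =
      (Polynomial.C (A.1 i) + Polynomial.X * Polynomial.C (H.1 i)) * line A H (word l) := by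
    rw [word_cons, map_mul]; simp [line]
  rw [this, add_mul, mul_assoc, Polynomial.coeff_add, Polynomial.coeff_C_mul,
    Polynomial.coeff_X_mul, Polynomial.coeff_C_mul, add_mulVec, mulVec_mulVec, mulVec_mulVec]

section
variable {g n m : ℕ} {A : symTuples g n} {v e : Fin n → ℝ} {b : Fin g → Fin n → ℝ}
  {z : List (Fin g) → ℝ}

lemma dotProduct_eval_word (hA : ∀ i, A.1 i *ᵥ e = 0) (hv : e ⬝ᵥ v = 0) (l : List (Fin g)) :
    e ⬝ᵥ (eval (word l) A *ᵥ v) = 0 := by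
  cases l with
  | nil => simpa [eval] using hv
  | cons i l => rw [eval_word_cons, ← symTuples_dotProduct, hA, zero_dotProduct]

/-- The first variation of a word in the direction `rankTwoTuple e b`: only the term that
substitutes the first letter survives, as the variables annihilate `e`. -/
lemma coeff_one_line_word (hA : ∀ i, A.1 i *ᵥ e = 0) (hv : e ⬝ᵥ v = 0)
    (hb : ∀ i (l : List (Fin g)), l.length ≤ m → b i ⬝ᵥ (eval (word l) A *ᵥ v) = z (i :: l))
    (hz : z [] = 0) (l : List (Fin g)) (hl : l.length ≤ m + 1) :
    (line A (rankTwoTuple e b) (word l)).coeff 1 *ᵥ v = z l • e := by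
  induction l with
  | nil => simp [hz, Polynomial.coeff_one]
  | cons i l ih =>
    simp only [List.length_cons] at hl
    rw [coeff_succ_line_word_cons, ih (by omega), mulVec_smul, hA, coeff_zero_line,
      rankTwoTuple_mulVec, dotProduct_eval_word hA hv, hb i l (by omega)]
    simp

/-- The second variation of a word in the direction `rankTwoTuple e b`. The word `r` collects the
letters already moved to the other side of the inner product, which makes the induction work. -/
lemma coeff_two_line_word (hA : ∀ i, A.1 i *ᵥ e = 0) (hv : e ⬝ᵥ v = 0)
    (hb : ∀ i (l : List (Fin g)), l.length ≤ m → b i ⬝ᵥ (eval (word l) A *ᵥ v) = z (i :: l))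
    (hbe : ∀ i, b i ⬝ᵥ e = 0) (hz : z [] = 0) (l r : List (Fin g))
    (hl : l.length + r.length ≤ m + 1) :
    ((line A (rankTwoTuple e b) (word l)).coeff 2 *ᵥ v) ⬝ᵥ (eval (word r) A *ᵥ v) =
      (e ⬝ᵥ e) * splitSum z r l := by
  induction l generalizing r with
  | nil => simp [splitSum, Polynomial.coeff_one]
  | cons i l ih =>
    simp only [List.length_cons] at hl
    rw [coeff_succ_line_word_cons, coeff_one_line_word hA hv hb hz l (by omega), mulVec_smul,
      rankTwoTuple_mulVec, hbe, add_dotProduct, symTuples_dotProduct, ← eval_word_cons,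
      ih (i :: r) (by simp only [List.length_cons]; omega), zero_smul, zero_add, smul_dotProduct,
      smul_dotProduct, hb i r (by omega), splitSum]
    simp only [smul_eq_mul]
    ring

end

/-- If no nonzero polynomial of degree at most `m` annihilates `(A, v)` and `e` is orthogonal to
all vectors `q(A) v`, then the values `b ⬝ᵥ w(A) v` on the words `w` of length at most `m` can be
prescribed by a vector `b` orthogonal to `e`. -/
lemma exists_dual_vector {g n m : ℕ} {A : symTuples g n} {v e : Fin n → ℝ}
    (hA : ∀ i, A.1 i *ᵥ e = 0) (hv : e ⬝ᵥ v = 0) (he : e ⬝ᵥ e ≠ 0)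
    (hinj : ∀ q ∈ wordsUpTo g m, eval q A *ᵥ v = 0 → q = 0) (y : List (Fin g) → ℝ) :
    ∃ b : Fin n → ℝ, (∀ l : List (Fin g), l.length ≤ m → b ⬝ᵥ (eval (word l) A *ᵥ v) = y l) ∧
      b ⬝ᵥ e = 0 := by
  let L : NCPoly g →ₗ[ℝ] (Fin n → ℝ) :=
    ((Matrix.mulVecBilin ℝ ℝ).flip : (Fin n → ℝ) →ₗ[ℝ]
      Matrix (Fin n) (Fin n) ℝ →ₗ[ℝ] (Fin n → ℝ)) v ∘ₗ
      (FreeAlgebra.lift ℝ (A : Fin g → Matrix (Fin n) (Fin n) ℝ)).toLinearMap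
  have hker : LinearMap.ker (L ∘ₗ (wordsUpTo g m).subtype) = ⊥ := by
    rw [Submodule.eq_bot_iff]
    intro q hq
    exact Subtype.ext (hinj q q.2 hq)
  obtain ⟨f, hf⟩ := LinearMap.exists_leftInverse_of_injective _ hker
  let φ : (Fin n → ℝ) →ₗ[ℝ] ℝ := pair y ∘ₗ (wordsUpTo g m).subtype ∘ₗ f
  let b₀ : Fin n → ℝ := fun k => φ (Pi.single k 1)
  have hb₀ : ∀ x, b₀ ⬝ᵥ x = φ x := fun x => by
    rw [LinearMap.pi_apply_eq_sum_univ φ x, dotProduct]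
    refine Finset.sum_congr rfl fun k _ => ?_
    have hk : (fun j => if k = j then (1 : ℝ) else 0) = Pi.single k 1 := by
      funext j
      simp [Pi.single_apply, eq_comm]
    rw [smul_eq_mul, mul_comm, hk]
  refine ⟨b₀ - ((b₀ ⬝ᵥ e) / (e ⬝ᵥ e)) • e, fun l hl => ?_, ?_⟩
  · rw [sub_dotProduct, smul_dotProduct, dotProduct_eval_word hA hv, smul_zero, sub_zero, hb₀]
    have := LinearMap.congr_fun hf ⟨word l, word_mem_wordsUpTo hl⟩
    change pair y (f (L (word l))).1 = y l
    have h2 : f (L (word l)) = ⟨word l, word_mem_wordsUpTo hl⟩ := this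
    rw [h2, pair_word]
  · rw [sub_dotProduct, smul_dotProduct, smul_eq_mul, div_mul_cancel₀ _ he, sub_self]

/-- Nonnegative curvature at a point `(Y, v)` whose tuple has a joint eigenvector `e` orthogonal
to `v` is an inequality between the coefficients of `p`, expanded around the joint eigenvalue. -/
lemma pair_splitSum_nonpos {g m n : ℕ} {p : NCPoly g} (hp : p ∈ wordsUpTo g (m + 1))
    {Y : symTuples g n} {v e : Fin n → ℝ} {c : Fin g → ℝ}
    (hcurv : HasPositiveCurvatureAt p ⟨n, Y, v⟩) (hY : ∀ i, Y.1 i *ᵥ e = c i • e)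
    (hv : e ⬝ᵥ v = 0) (he : 0 < e ⬝ᵥ e)
    (hinj : ∀ q ∈ wordsUpTo g m, eval q Y *ᵥ v = 0 → q = 0)
    {z : List (Fin g) → ℝ} (hz : z [] = 0) (hzp : pair z (translate c p) = 0) :
    pair (splitSum z []) (translate c p) ≤ 0 := by
  set A := Y - scalarTuple n c with hAdef
  have hA : ∀ i, A.1 i *ᵥ e = 0 := fun i => by
    simp [hAdef, scalarTuple, sub_mulVec, hY, smul_mulVec]
  have hinj' : ∀ q ∈ wordsUpTo g m, eval q A *ᵥ v = 0 → q = 0 := by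
    intro q hq h0
    have h1 : translate (-c) q = 0 := hinj _ (translate_mem_wordsUpTo _ hq) (by
      rw [← eval_translate c]
      have := translate_neg_translate (-c) q
      rw [neg_neg] at this
      rw [this]; exact h0)
    have := translate_neg_translate (-c) q
    rw [← this, h1, map_zero]
  choose b hb hbe using fun i => exists_dual_vector hA hv he.ne' hinj' fun l => z (i :: l)
  have hp' := translate_mem_wordsUpTo c hp
  have hline : line Y (rankTwoTuple e b) p = line A (rankTwoTuple e b) (translate c p) :=
    (line_translate c Y _ p).symm
  have h1 : (line A (rankTwoTuple e b) (translate c p)).coeff 1 *ᵥ v =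
      pair z (translate c p) • e := by
    refine eqOn_wordsUpTo (m := m + 1)
      (φ := ((Matrix.mulVecBilin ℝ ℝ).flip : (Fin n → ℝ) →ₗ[ℝ]
        Matrix (Fin n) (Fin n) ℝ →ₗ[ℝ] (Fin n → ℝ)) v ∘ₗ
        (Polynomial.lcoeff (Matrix (Fin n) (Fin n) ℝ) 1).restrictScalars ℝ ∘ₗ
        (line A (rankTwoTuple e b)).toLinearMap)
      (ψ := (LinearMap.toSpanSingleton ℝ _ e) ∘ₗ pair z) (fun l hl => ?_) hp'
    simpa using coeff_one_line_word hA hv hb hz l hl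
  have h2 : ((line A (rankTwoTuple e b) (translate c p)).coeff 2 *ᵥ v) ⬝ᵥ v =
      (e ⬝ᵥ e) * pair (splitSum z []) (translate c p) := by
    refine eqOn_wordsUpTo (m := m + 1)
      (φ := (dotProductBilin ℝ ℝ).flip v ∘ₗ ((Matrix.mulVecBilin ℝ ℝ).flip : (Fin n → ℝ) →ₗ[ℝ]
        Matrix (Fin n) (Fin n) ℝ →ₗ[ℝ] (Fin n → ℝ)) v ∘ₗ
        (Polynomial.lcoeff (Matrix (Fin n) (Fin n) ℝ) 2).restrictScalars ℝ ∘ₗ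
        (line A (rankTwoTuple e b)).toLinearMap)
      (ψ := (e ⬝ᵥ e) • pair (splitSum z [])) (fun l hl => ?_) hp'
    simpa [eval] using coeff_two_line_word hA hv hb hbe hz l [] (by simpa using hl)
  have h3 : 0 ≤ secondFundamentalForm p ⟨n, Y, v⟩ (rankTwoTuple e b) := by
    refine hcurv _ ?_
    change eval₂ (deriv p) Y (rankTwoTuple e b) *ᵥ v = 0
    rw [eval₂_deriv, hline, h1, hzp, zero_smul]
  change 0 ≤ -((eval₂ (hessian p) Y (rankTwoTuple e b) *ᵥ v) ⬝ᵥ v) at h3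
  rw [eval₂_hessian, hline, smul_mulVec, smul_dotProduct, h2, smul_eq_mul] at h3
  by_contra! hpos
  have := mul_pos he hpos
  linarith

/-- A scalar full rank point `c` produces joint eigenvectors: in the direct sum of a full rank
point with two copies of `c`, the difference of the two copies is one. -/
lemma exists_translate_pair_splitSum_nonpos {g m : ℕ} {p : NCPoly g}
    (hp : p ∈ wordsUpTo g (m + 1)) {O : Set (Σ n : ℕ, symTuples g n)} (hO : IsAlgebraicallyOpen O)
    (h1 : ∃ (X : symTuples g 1) (v : Fin 1 → ℝ), (⟨1, X, v⟩ : Point g) ∈ fullRankPoints p O)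
    (hcurv : ∀ P ∈ fullRankPoints p O, HasPositiveCurvatureAt p P)
    (hS : ∀ q ∈ wordsUpTo g m, VanishesOn q (fullRankPoints p O) → q = 0) :
    ∃ c : Fin g → ℝ, ∀ z : List (Fin g) → ℝ, z [] = 0 → pair z (translate c p) = 0 →
      pair (splitSum z []) (translate c p) ≤ 0 := by
  obtain ⟨X, v, hX⟩ := h1
  -- A zero vector is not a full rank point, as `p'(X)[H] 0 = 0`.
  have hv : v ≠ 0 := by
    rintro rfl
    obtain ⟨H, hH⟩ := hX.1.2 1
    simp only [mulVec_zero] at hH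
    exact zero_ne_one (congrFun hH 0)
  have hXv : ∀ i, X.1 i *ᵥ v = X.1 i 0 0 • v := fun i => by
    funext k
    fin_cases k
    simp [mulVec, dotProduct]
  obtain ⟨⟨n, Y, w⟩, hY, hann⟩ := exists_point_not_annihilated hO ⟨_, hX⟩ hS
  have hsum := directSum_mem_fullRankPoints hO (directSum_mem_fullRankPoints hO hY hX) hX
  refine ⟨fun i => X.1 i 0 0, fun z hz hzp => ?_⟩
  refine pair_splitSum_nonpos hp (e := blockVec (blockVec (0 : Fin n → ℝ) v) (-v))
    (hcurv _ hsum) (fun i => ?_) ?_ ?_ (fun q hq h0 => hann q hq ?_) hz hzp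
  · change blockDiag _ _ (blockDiag _ _ (Y.1 i, X.1 i), X.1 i) *ᵥ _ = _
    rw [blockDiag_mulVec, blockDiag_mulVec, mulVec_neg, hXv, mulVec_zero]
    funext k
    obtain ⟨k, rfl⟩ := finSumFinEquiv.surjective k
    rcases k with k | k
    · obtain ⟨k, rfl⟩ := finSumFinEquiv.surjective k
      rcases k with k | k <;> simp [blockVec]
    · simp [blockVec]
  · simp [blockVec_dotProduct]
  · rw [blockVec_dotProduct, blockVec_dotProduct]
    have : 0 < v ⬝ᵥ v := by
      simpa using dotProduct_star_self_pos_iff.2 hv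
    simpa using this
  · rw [eval_directSum, eval_directSum, blockDiag_mulVec, blockDiag_mulVec, blockVec_eq_zero,
      blockVec_eq_zero] at h0
    exact h0.1.1

/-! ### Choice of the test weights -/

open Classical in
/-- `splitSum` of weights with finite support as a sum over pairs of words of the support. -/
lemma splitSum_eq_sum {g : ℕ} {z : List (Fin g) → ℝ}
    {T : Finset (List (Fin g))} (hT : ∀ l, z l ≠ 0 → l ∈ T) (r l : List (Fin g)) :
    splitSum z r l = ∑ a ∈ T, ∑ b ∈ T,
      if ∃ u, u ≠ [] ∧ a = u.reverse ++ r ∧ l = u ++ b then z a * z b else 0 := by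
  induction l generalizing r with
  | nil =>
    refine (Finset.sum_eq_zero fun a _ => Finset.sum_eq_zero fun b _ => if_neg ?_).symm
    rintro ⟨u, hu, -, h⟩
    exact hu (List.append_eq_nil_iff.1 h.symm).1
  | cons i l ih =>
    have hsingle : z (i :: r) * z l =
        ∑ a ∈ T, ∑ b ∈ T, if a = i :: r ∧ b = l then z a * z b else 0 := by
      by_cases h1 : i :: r ∈ T
      · by_cases h2 : l ∈ T
        · rw [Finset.sum_eq_single_of_mem _ h1, Finset.sum_eq_single_of_mem _ h2] <;> simp_all
        · rw [not_not.1 (mt (hT l) h2), mul_zero]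
          refine (Finset.sum_eq_zero fun a _ => Finset.sum_eq_zero fun b hb => if_neg ?_).symm
          rintro ⟨-, rfl⟩
          exact h2 hb
      · rw [not_not.1 (mt (hT _) h1), zero_mul]
        refine (Finset.sum_eq_zero fun a ha => Finset.sum_eq_zero fun b _ => if_neg ?_).symm
        rintro ⟨rfl, -⟩
        exact h1 ha
    rw [splitSum, ih, hsingle, ← Finset.sum_add_distrib]
    refine Finset.sum_congr rfl fun a _ => ?_
    rw [← Finset.sum_add_distrib]
    refine Finset.sum_congr rfl fun b _ => ?_
    have hiff : (∃ u, u ≠ [] ∧ a = u.reverse ++ r ∧ i :: l = u ++ b) ↔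
        (∃ u, u ≠ [] ∧ a = u.reverse ++ i :: r ∧ l = u ++ b) ∨ (a = i :: r ∧ b = l) := by
      constructor
      · rintro ⟨u, hu, rfl, h⟩
        cases u with
        | nil => exact absurd rfl hu
        | cons j u =>
          obtain ⟨rfl, rfl⟩ := List.cons.inj h
          rcases eq_or_ne u [] with rfl | hu'
          · right; simp
          · left; exact ⟨u, hu', by simp, rfl⟩
      · rintro (⟨u, -, rfl, rfl⟩ | ⟨rfl, rfl⟩)
        · exact ⟨i :: u, by simp, by simp, by simp⟩
        · exact ⟨[i], by simp, by simp, by simp⟩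
    have hdisj : (a = i :: r ∧ b = l) →
        ¬ ∃ u, u ≠ [] ∧ a = u.reverse ++ i :: r ∧ l = u ++ b := by
      rintro ⟨rfl, rfl⟩ ⟨u, hu, -, h⟩
      exact hu (by simpa using h)
    by_cases h1 : a = i :: r ∧ b = l
    · rw [if_neg (hdisj h1), if_pos h1, if_pos (hiff.2 (Or.inr h1)), zero_add]
    · rw [if_neg h1, add_zero]
      exact if_congr ((or_iff_left h1).symm.trans hiff.symm) rfl rfl

open Classical in
/-- For an empty prefix the first factor need not be required to be nonempty, as `z [] = 0`. -/
lemma splitSum_nil_eq_sum {g : ℕ} {z : List (Fin g) → ℝ}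
    (hz : z [] = 0) {T : Finset (List (Fin g))} (hT : ∀ l, z l ≠ 0 → l ∈ T) (l : List (Fin g)) :
    splitSum z [] l = ∑ a ∈ T, ∑ b ∈ T, if a.reverse ++ b = l then z a * z b else 0 := by
  rw [splitSum_eq_sum hT]
  refine Finset.sum_congr rfl fun a _ => Finset.sum_congr rfl fun b _ => ?_
  rcases eq_or_ne a [] with rfl | ha
  · simp [hz]
  · refine if_congr ⟨?_, ?_⟩ rfl rfl
    · rintro ⟨u, -, rfl, rfl⟩; simp
    · rintro rfl; exact ⟨a.reverse, by simpa using ha, by simp, rfl⟩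

/-- In degree at least three the curvature inequality fails for suitable weights: if `i :: b` is a
word of top degree in `p`, then the coefficients of `[i]` and `b` in the weights contribute a
nonzero multiple of their product, whereas `b` alone contributes nothing. The coefficient of
`i :: b` in the weights is invisible to the second variation and restores tangency. -/
lemma exists_pair_splitSum_pos {g m : ℕ} (hm : 2 ≤ m) {p : NCPoly g} (hp : star p = p)
    (hdeg : p ∈ wordsUpTo g (m + 1)) (hdeg' : p ∉ wordsUpTo g m) :
    ∃ z : List (Fin g) → ℝ, z [] = 0 ∧ pair z p = 0 ∧ 0 < pair (splitSum z []) p := by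
  classical
  obtain ⟨t, ht, hk⟩ := exists_coef_ne_zero hdeg hdeg'
  obtain ⟨i, b, rfl⟩ : ∃ i b, t = i :: b := by
    cases t with
    | nil => simp at ht
    | cons i b => exact ⟨i, b, rfl⟩
  simp only [List.length_cons, add_left_inj] at ht
  set k := coef (i :: b) p with hkdef
  -- `β` makes the second variation `coef [i, i] p + 2 * β * k` equal to `1`, and `s` makes the
  -- first variation vanish.
  set β := (1 - coef [i, i] p) / (2 * k) with hβ
  set s := -(coef [i] p + β * coef b p) / k with hs
  let z : List (Fin g) → ℝ := fun l =>
    (if l = [i] then 1 else 0) + β * (if l = b then 1 else 0) + s * (if l = i :: b then 1 else 0)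
  have hbi : b ≠ [i] := by rintro rfl; simp at ht; omega
  have hib : i :: b ≠ [i] := by
    intro h
    have := congrArg List.length h
    simp only [List.length_cons, List.length_nil] at this
    omega
  have hbb : i :: b ≠ b := by
    intro h
    have := congrArg List.length h
    simp at this
  have hz0 : z [] = 0 := by
    have : b ≠ [] := by rintro rfl; simp at ht; omega
    simp [z, this.symm]
  have hz1 : z [i] = 1 := by simp [z, hbi.symm, hib.symm]
  have hz2 : z b = β := by simp [z, hbi, hbb.symm]
  refine ⟨z, hz0, ?_, ?_⟩
  · have : pair z = coef [i] + β • coef b + s • coef (i :: b) := by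
      refine linearMap_ext_word fun l => ?_
      simp [coef_word, z]
    rw [this]
    simp only [LinearMap.add_apply, LinearMap.smul_apply, smul_eq_mul, ← hkdef]
    rw [hs]
    field_simp
    ring
  · have h : pair (splitSum z []) p =
        (coef [i, i] + β • (coef (i :: b) + coef (i :: b).reverse)) p := by
      refine eqOn_wordsUpTo (m := m + 1) (fun l hl => ?_) hdeg
      rw [pair_word, splitSum_nil_eq_sum hz0 (T := {[i], b, i :: b}) (fun l hl => ?_)]
      · have hlong : ∀ x y : List (Fin g), m + 1 < x.length + y.length →
            x.reverse ++ y ≠ l := by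
          rintro x y hxy rfl
          simp at hl; omega
        have e : ∀ x y : List (Fin g), x.reverse ++ y = l ↔ l = x.reverse ++ y :=
          fun x y => eq_comm
        have hn1 : [i] ∉ ({b, i :: b} : Finset (List (Fin g))) := by
          rw [Finset.mem_insert, Finset.mem_singleton]
          rintro (h | h)
          exacts [hbi h.symm, hib h.symm]
        have hn2 : b ∉ ({i :: b} : Finset (List (Fin g))) := by
          rw [Finset.mem_singleton]
          exact hbb.symm
        simp only [Finset.sum_insert hn1, Finset.sum_insert hn2, Finset.sum_singleton]
        -- Of the nine products of two words in the support, all but three are longer than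
        -- `m + 1`; for `b.reverse ++ b` this is where `2 ≤ m` is needed.
        rw [if_neg (hlong [i] (i :: b) (by simp; omega)), if_neg (hlong b b (by omega)),
          if_neg (hlong b (i :: b) (by simp; omega)), if_neg (hlong (i :: b) [i] (by simp; omega)),
          if_neg (hlong (i :: b) b (by simp; omega)),
          if_neg (hlong (i :: b) (i :: b) (by simp; omega)), hz1, hz2]
        simp only [e]
        simp [coef_word, add_assoc]
      · by_contra hlT
        simp only [Finset.mem_insert, Finset.mem_singleton, not_or] at hlT
        exact hl (by simp [z, hlT])
    rw [h]
    have hrev : coef (i :: b).reverse p = k := by rw [← coef_star, hp]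
    simp only [LinearMap.add_apply, LinearMap.smul_apply, smul_eq_mul, ← hkdef, hrev]
    have : coef [i, i] p + β * (k + k) = 1 := by
      rw [hβ]; field_simp; ring
    rw [this]
    exact one_pos

/-- The weights `y i * y j` on the words `[i, j]`, and `0` on all others. -/
def quadWeight {g : ℕ} (y : Fin g → ℝ) : List (Fin g) → ℝ
  | [i, j] => y i * y j
  | _ => 0

/-- In degree at most two the curvature inequality says that the quadratic part of `p` is a
negative semidefinite form; a word of degree two restores tangency. -/
lemma pair_quadWeight_nonpos {g : ℕ} {p : NCPoly g} (hdeg : p ∈ wordsUpTo g 2)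
    (hdeg' : p ∉ wordsUpTo g 1)
    (h : ∀ z : List (Fin g) → ℝ, z [] = 0 → pair z p = 0 → pair (splitSum z []) p ≤ 0)
    (y : Fin g → ℝ) : pair (quadWeight y) p ≤ 0 := by
  classical
  obtain ⟨t, ht, hk⟩ := exists_coef_ne_zero hdeg hdeg'
  let y' : List (Fin g) → ℝ := fun l => match l with
    | [i] => y i
    | _ => 0
  set s := -pair y' p / coef t p with hs
  let z : List (Fin g) → ℝ := fun l => y' l + s * (if l = t then 1 else 0)
  have hz0 : z [] = 0 := by
    have : t ≠ [] := by rintro rfl; simp at ht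
    simp [z, y', this.symm]
  have hz1 : ∀ i, z [i] = y i := by
    intro i
    have : t ≠ [i] := by rintro rfl; simp at ht
    simp [z, y', this.symm]
  have hzp : pair z p = 0 := by
    have : pair z = pair y' + s • coef t := by
      refine linearMap_ext_word fun l => ?_
      simp [coef_word, z]
    rw [this]
    simp only [LinearMap.add_apply, LinearMap.smul_apply, smul_eq_mul]
    rw [hs]
    field_simp
    ring
  have heq : pair (splitSum z []) p = pair (quadWeight y) p := by
    refine eqOn_wordsUpTo (m := 2) (fun l hl => ?_) hdeg
    rw [pair_word, pair_word]
    match l, hl with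
    | [], _ => rfl
    | [i], _ => simp [splitSum, quadWeight, hz0]
    | [i, j], _ => simp [splitSum, quadWeight, hz0, hz1]
    | i :: j :: k :: l, hl => simp at hl
  rw [← heq]
  exact h z hz0 hzp

lemma pair_quadWeight_eq_zero {g : ℕ} {p : NCPoly g} (hdeg : p ∈ wordsUpTo g 1)
    (y : Fin g → ℝ) : pair (quadWeight y) p = 0 := by
  refine eqOn_wordsUpTo (m := 1) (ψ := 0) (fun l hl => ?_) hdeg
  rw [pair_word]
  match l, hl with
  | [], _ => rfl
  | [i], _ => rfl
  | i :: j :: l, hl => simp at hl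

/-! ### Concavity of quadratic polynomials -/

lemma isHermitian_eval {g n : ℕ} {p : NCPoly g} (hp : star p = p) (X : symTuples g n) :
    (eval p X).IsHermitian := by
  rw [Matrix.IsHermitian, conjTranspose_eq_transpose_of_trivial, ← eval_star, hp]

/-- The concavity defect of a polynomial of degree at most two is governed by its quadratic
part. -/
lemma dotProduct_concavity_defect {g n : ℕ} {p : NCPoly g} (hdeg : p ∈ wordsUpTo g 2)
    (X Y : symTuples g n) (t : ℝ) (ξ : Fin n → ℝ) :
    ξ ⬝ᵥ ((eval p (t • X + (1 - t) • Y) - (t • eval p X + (1 - t) • eval p Y)) *ᵥ ξ) =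
      -(t * (1 - t)) * ∑ k, pair (quadWeight fun i => ((X - Y).1 i *ᵥ ξ) k) p := by
  let E : ∀ Z : symTuples g n, NCPoly g →ₗ[ℝ] ℝ := fun Z =>
    (dotProductBilin ℝ ℝ) ξ ∘ₗ ((Matrix.mulVecBilin ℝ ℝ).flip : (Fin n → ℝ) →ₗ[ℝ]
      Matrix (Fin n) (Fin n) ℝ →ₗ[ℝ] (Fin n → ℝ)) ξ ∘ₗ
      (FreeAlgebra.lift ℝ (Z : Fin g → Matrix (Fin n) (Fin n) ℝ)).toLinearMap
  have hE : ∀ Z q, E Z q = ξ ⬝ᵥ (eval q Z *ᵥ ξ) := fun _ _ => rfl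
  have key : (E (t • X + (1 - t) • Y) - (t • E X + (1 - t) • E Y)) p =
      ((-(t * (1 - t))) • ∑ k, pair (quadWeight fun i => ((X - Y).1 i *ᵥ ξ) k)) p := by
    refine eqOn_wordsUpTo (m := 2) (fun l hl => ?_) hdeg
    simp only [LinearMap.sub_apply, LinearMap.add_apply, LinearMap.smul_apply,
      LinearMap.sum_apply, pair_word, smul_eq_mul, hE]
    match l, hl with
    | [], _ =>
      simp [quadWeight, eval]
      ring
    | [i], _ =>
      simp [quadWeight, eval, word, add_mulVec, smul_mulVec]
    | [i, j], _ =>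
      have hsum : ∑ k, quadWeight (fun i => ((X - Y).1 i *ᵥ ξ) k) [i, j] =
          ξ ⬝ᵥ ((X - Y).1 i *ᵥ ((X - Y).1 j *ᵥ ξ)) := by
        rw [← symTuples_dotProduct]; rfl
      have hone : ∀ Z : symTuples g n, eval 1 Z = 1 := fun Z => map_one _
      rw [hsum]
      simp only [eval_word_cons, word_nil, hone, one_mulVec]
      simp only [Submodule.coe_add, Submodule.coe_smul, Submodule.coe_sub, Pi.add_apply,
        Pi.smul_apply, Pi.sub_apply, add_mulVec, sub_mulVec, smul_mulVec, mulVec_add, mulVec_sub,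
        mulVec_smul, dotProduct_add, dotProduct_sub, dotProduct_smul, smul_eq_mul]
      ring
    | i :: j :: k :: l, hl => simp at hl
  simp only [LinearMap.sub_apply, LinearMap.add_apply, LinearMap.smul_apply,
    LinearMap.sum_apply, smul_eq_mul, hE] at key
  rw [← key]
  simp only [sub_mulVec, add_mulVec, smul_mulVec, dotProduct_sub, dotProduct_add, dotProduct_smul,
    smul_eq_mul]

lemma isConcave_of_pair_quadWeight_nonpos {g : ℕ} {p : NCPoly g} (hp : star p = p)
    (hdeg : p ∈ wordsUpTo g 2) (h : ∀ y, pair (quadWeight y) p ≤ 0) : IsConcave p := by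
  intro n X Y t ht ht'
  refine Matrix.PosSemidef.of_dotProduct_mulVec_nonneg ?_ fun ξ => ?_
  · have hs : ∀ (c : ℝ) (Z : symTuples g n), (c • eval p Z).IsHermitian := fun c Z =>
      (isHermitian_eval hp Z).smul (IsSelfAdjoint.all c)
    exact (isHermitian_eval hp _).sub ((hs _ _).add (hs _ _))
  · rw [star_trivial, dotProduct_concavity_defect hdeg, neg_mul, neg_nonneg]
    exact mul_nonpos_of_nonneg_of_nonpos (mul_nonneg ht (sub_nonneg.2 ht'))
      (Finset.sum_nonpos fun k _ => h _)

lemma IsConcave.of_translate {g : ℕ} {p : NCPoly g} {c : Fin g → ℝ}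
    (h : IsConcave (translate c p)) : IsConcave p := by
  intro n X Y t ht ht'
  have hc : t • X + (1 - t) • Y - scalarTuple n c =
      t • (X - scalarTuple n c) + (1 - t) • (Y - scalarTuple n c) := by module
  rw [← eval_translate c (t • X + (1 - t) • Y), ← eval_translate c X, ← eval_translate c Y, hc]
  exact h n _ _ t ht ht'

end NCPoly

theorem corollary1p2 (g : ℕ) (p : NCPoly g) (hp : NCPoly.IsSymmetric p)
    (O : Set (Σ n : ℕ, NCPoly.symTuples g n)) (hO : NCPoly.IsAlgebraicallyOpen O)
    (h1 : ∃ (X : NCPoly.symTuples g 1) (v : Fin 1 → ℝ),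
      (⟨1, X, v⟩ : NCPoly.Point g) ∈ NCPoly.fullRankPoints p O)
    (hcurv : ∀ P ∈ NCPoly.fullRankPoints p O, NCPoly.HasPositiveCurvatureAt p P)
    (hmin : NCPoly.IsMinDegreeDefining 0 p (NCPoly.fullRankPoints p O)) :
    NCPoly.degree p ≤ 2 ∧ NCPoly.IsConcave p := by
  open NCPoly in
  by_cases hd : degree p ≤ 1
  · have hp1 := degree_le_iff.1 hd
    exact ⟨hd.trans one_le_two, isConcave_of_pair_quadWeight_nonpos hp
      (wordsUpTo_mono one_le_two hp1) fun y => (pair_quadWeight_eq_zero hp1 y).le⟩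
  obtain ⟨m, hm⟩ : ∃ m, degree p = m + 1 := ⟨degree p - 1, by omega⟩
  have hdeg : p ∈ wordsUpTo g (m + 1) := degree_le_iff.1 hm.le
  have hdeg' : p ∉ wordsUpTo g m := fun h => by have := degree_le_iff.2 h; omega
  obtain ⟨c, hc⟩ := exists_translate_pair_splitSum_nonpos hdeg hO h1 hcurv fun q hq hq0 => by
    by_contra hne
    have := hmin.degree_le q hne hq0
    have := degree_le_iff.2 hq
    omega
  have hsymm : star (translate c p) = translate c p := by rw [star_translate, hp]
  have hcdeg := (translate_mem_wordsUpTo_iff c).2 hdeg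
  have hcdeg' := mt (translate_mem_wordsUpTo_iff c).1 hdeg'
  have hm1 : m = 1 := by
    by_contra hne
    obtain ⟨z, hz, hzp, hpos⟩ := exists_pair_splitSum_pos (by omega) hsymm hcdeg hcdeg'
    exact absurd (hc z hz hzp) (not_le.2 hpos)
  subst hm1
  exact ⟨hm.le, (isConcave_of_pair_quadWeight_nonpos hsymm hcdeg
    (pair_quadWeight_nonpos hcdeg hcdeg' hc)).of_translate⟩
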